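/- Let $n,m\ge 1$, write $B_\rho(y)\subset\mathbb R^n$ for the open ball and $B_1=B_1(0)$, write $s^+=\max(s,0)$, and let $|\cdot|$ be the Euclidean norm. For a function $U=(u^1,\dots,u^m)$ on $B_1$ put $B_1^+(U)=B_1\cap\{|U|>0\}$ and $F(U)=B_1\cap\partial B_1^+(U)$. We say that $U\in C(B_1,\mathbb R^m)$ is a viscosity solution in $B_1$ of the vectorial one-phase problem $$\Delta U=0\ \text{ in } B_1^+(U),\qquad |\nabla|U||=1\ \text{ on } F(U),$$ if every $u^i$ is harmonic in $B_1^+(U)$ and, for every $y\in F(U)$ and every function $\varphi$ that is $C^2$ in a neighborhood of $y$: 1. if $|\nabla\varphi(y)|>1$, then for no unit vector $f\in\mathbb R^m$ is $\langle U,f\rangle$ touched by below by $\varphi$ at $y$, i.e. it does not happen that $\varphi(y)=\langle U(y),f\rangle$ and $\varphi\le\langle U,f\rangle$ near $y$; 2. if $\varphi(y)=0$ and $0<|\nabla\varphi(y)|<1$, then $|U|$ is not touched by above by $\varphi^+$ at $y$, i.e. it does not happen that $|U|\le\varphi^+$ near $y$. **Theorem 2.1.** There are constants $\bar\varepsilon>0$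 and $0<c<1$, depending only on $n$ and $m$, such that the following holds. Let $U$ be a viscosity solution in $B_1$, let $x_0\in B_1^+(U)\cup F(U)$, $r>0$ with $B_r(x_0)\subset B_1$, and $a_0,b_0\in\mathbb R$. Suppose that $$x_n+a_0\le u^1\le|U|\le(x_n+b_0)^+\quad\text{in }B_r(x_0),\qquad b_0-a_0\le\bar\varepsilon r,$$ and $$|u^i|\le r\left(\frac{b_0-a_0}{r}\right)^{3/4}\quad\text{in }B_{r/2}(x_0),\qquad i=2,\dots,m.$$ Then there are $a_1,b_1$ with $$a_0\le a_1\le b_1\le b_0,\qquad b_1-a_1=(1-c)(b_0-a_0),$$ such that $$x_n+a_1\le u^1\le|U|\le(x_n+b_1)^+\quad\text{in }B_{r/20}(x_0).$$ -/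

import Mathlib

/-! The vectorial one-phase (Bernoulli) free boundary problem
`Δ U = 0` in `{|U| > 0}`, `|∇ |U|| = 1` on the free boundary, in the viscosity sense. -/

namespace VectorialOnePhase

/-- The positivity set `Ω(U) = Ω ∩ {|U| > 0}`. -/
def positivitySet {n m : ℕ} (Ω : Set (EuclideanSpace ℝ (Fin n)))
    (U : EuclideanSpace ℝ (Fin n) → EuclideanSpace ℝ (Fin m)) :
    Set (EuclideanSpace ℝ (Fin n)) :=
  {x | x ∈ Ω ∧ 0 < ‖U x‖}

/-- The free boundary `F(U) = Ω ∩ ∂Ω(U)`. -/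
def freeBoundary {n m : ℕ} (Ω : Set (EuclideanSpace ℝ (Fin n)))
    (U : EuclideanSpace ℝ (Fin n) → EuclideanSpace ℝ (Fin m)) :
    Set (EuclideanSpace ℝ (Fin n)) :=
  Ω ∩ frontier (positivitySet Ω U)

/-- `φ` touches `u` by below at `x₀`: the values agree at `x₀` and `φ ≤ u` near `x₀`. -/
def TouchesBelow {n : ℕ} (φ u : EuclideanSpace ℝ (Fin n) → ℝ)
    (x₀ : EuclideanSpace ℝ (Fin n)) : Prop :=
  φ x₀ = u x₀ ∧ ∀ᶠ x in nhds x₀, φ x ≤ u x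

/-- `φ` touches `u` by above at `x₀`: the values agree at `x₀` and `u ≤ φ` near `x₀`. -/
def TouchesAbove {n : ℕ} (φ u : EuclideanSpace ℝ (Fin n) → ℝ)
    (x₀ : EuclideanSpace ℝ (Fin n)) : Prop :=
  φ x₀ = u x₀ ∧ ∀ᶠ x in nhds x₀, u x ≤ φ x

/-- `U ∈ C(Ω, ℝᵐ)` is a viscosity solution in the open set `Ω` of the vectorial one-phase problem.
Since `|U| ≥ 0` vanishes on the free boundary, touching `|U|` by above with a test function `φ` of
nonzero gradient is understood, as usual in one-phase problems, as touching by its positive part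
`φ⁺` (equivalently, `|U| ≤ φ` is only asked on the set `{|U| > 0}`, near the point). -/
structure IsViscositySolution {n m : ℕ} (Ω : Set (EuclideanSpace ℝ (Fin n)))
    (U : EuclideanSpace ℝ (Fin n) → EuclideanSpace ℝ (Fin m)) : Prop where
  continuousOn : ContinuousOn U Ω
  harmonic : ∀ i : Fin m,
    InnerProductSpace.HarmonicOnNhd (fun x => U x i) (positivitySet Ω U)
  not_touchesBelow : ∀ x₀ ∈ freeBoundary Ω U, ∀ φ : EuclideanSpace ℝ (Fin n) → ℝ,
    ContDiffAt ℝ 2 φ x₀ → 1 < ‖gradient φ x₀‖ →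
      ∀ f : EuclideanSpace ℝ (Fin m), ‖f‖ = 1 →
        ¬ TouchesBelow φ (fun x => inner ℝ (U x) f) x₀
  not_touchesAbove : ∀ x₀ ∈ freeBoundary Ω U, ∀ φ : EuclideanSpace ℝ (Fin n) → ℝ,
    ContDiffAt ℝ 2 φ x₀ → φ x₀ = 0 → gradient φ x₀ ≠ 0 → ‖gradient φ x₀‖ < 1 →
      ¬ TouchesAbove (fun x => max (φ x) 0) (fun x => ‖U x‖) x₀

/-- `xₙ + a ≤ u¹ ≤ |U| ≤ (xₙ + b)⁺` on the set `S`. The space dimension is `n + 1 ≥ 1`, the number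
of components is `m + 1 ≥ 1`; the last coordinate of `x` is `x (Fin.last n)` and the first
component of `U` is `U x 0`. -/
def TrappedOn {n m : ℕ}
    (U : EuclideanSpace ℝ (Fin (n + 1)) → EuclideanSpace ℝ (Fin (m + 1))) (a b : ℝ)
    (S : Set (EuclideanSpace ℝ (Fin (n + 1)))) : Prop :=
  ∀ x ∈ S, x (Fin.last n) + a ≤ U x 0 ∧ U x 0 ≤ ‖U x‖ ∧ ‖U x‖ ≤ max (x (Fin.last n) + b) 0

end VectorialOnePhase

/-! Write `η = b₀ - a₀` and let `p` lie at height `r / 5` above `x₀`. Near `p` the function `u¹ -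
(xₙ + a₀)` is harmonic with values in `[0, η]`, so on a small ball around `p` it varies by at most
`η / 4` from its value at `p` (`harmonic_abs_sub_le`). If that value is at least `η / 2`, then `u¹`
lies a fixed fraction of `η` above its lower bound there. Otherwise `u¹` lies below its upper bound,
and so does `|U|`: the other components enter `|U|` quadratically, and the exponent `3/4 > 1/2`
makes their contribution small compared with `η` (`norm_le_first_add`).

The gain is carried to `B_{r/20}(x₀)` by perturbing `xₙ + a₀` or `xₙ + b₀` with a Gaussian bump of
height `η / 8` centered at `p` (`barrier_le`, `norm_le_barrier`). Away from `p` the bump is strictly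
subharmonic, which excludes contact inside `{|U| > 0}`. Contact on the free boundary can only occur
below `p`, where the bump pushes the slope above 1 (from below) or under 1 (from above), against the
viscosity conditions. -/

namespace VectorialOnePhase

open InnerProductSpace Laplacian Topology Filter

/-! ### Maximum principle, explicit Laplacians, oscillation of harmonic functions. -/

section Calculus

variable {E : Type*} [NormedAddCommGroup E] [InnerProductSpace ℝ E] [FiniteDimensional ℝ E]

/-- Along a line, the second derivative at a local maximum is nonpositive. -/
lemma deriv_deriv_nonpos_of_isLocalMax {f : ℝ → ℝ} {x : ℝ} (hf : ContinuousAt f x)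
    (h : IsLocalMax f x) : deriv (deriv f) x ≤ 0 := by
  by_contra! hpos
  have hmin := isLocalMin_of_deriv_deriv_pos hpos h.deriv_eq_zero hf
  have hconst : f =ᶠ[𝓝 x] fun _ => f x := by
    filter_upwards [h, hmin] with y h₁ h₂ using le_antisymm h₁ h₂
  have : deriv (deriv f) x = 0 := by
    rw [hconst.deriv.deriv_eq]
    simp
  linarith

/-- The Laplacian is nonpositive at a local maximum. -/
lemma laplacian_nonpos_of_isLocalMax {f : E → ℝ} {x : E} (hf : ContDiffAt ℝ 2 f x)
    (h : IsLocalMax f x) : Δ f x ≤ 0 := by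
  rw [laplacian_eq_iteratedFDeriv_stdOrthonormalBasis]
  refine Finset.sum_nonpos fun i _ => ?_
  set v := stdOrthonormalBasis ℝ E i
  have hline : ∀ t : ℝ, HasDerivAt (fun t : ℝ => x + t • v) v t := fun t => by
    simpa using ((hasDerivAt_id t).smul_const v).const_add x
  have hcont : Tendsto (fun t : ℝ => x + t • v) (𝓝 0) (𝓝 x) := by
    simpa using (hline 0).continuousAt.tendsto
  have hd : deriv (fun t : ℝ => f (x + t • v)) =ᶠ[𝓝 0] fun t => fderiv ℝ f (x + t • v) v := by
    filter_upwards [hcont.eventually (hf.eventually (by simp))] with t ht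
    exact ((ht.differentiableAt (by simp)).hasFDerivAt.comp_hasDerivAt t (hline t)).deriv
  have hf' : DifferentiableAt ℝ (fderiv ℝ f) x :=
    (hf.fderiv_right (m := 1) (by norm_num)).differentiableAt (by simp)
  have hdd : deriv (deriv fun t : ℝ => f (x + t • v)) 0 = fderiv ℝ (fderiv ℝ f) x v v := by
    rw [hd.deriv_eq]
    have h₀ : HasFDerivAt (fun y => fderiv ℝ f y v) ((fderiv ℝ (fderiv ℝ f) x).flip v)
        (x + (0 : ℝ) • v) := by
      have h₁ := hf'.hasFDerivAt.clm_apply (hasFDerivAt_const v x)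
      rw [zero_smul, add_zero]
      exact h₁.congr_fderiv (by ext; simp)
    exact (h₀.comp_hasDerivAt (0 : ℝ) (hline 0)).deriv
  rw [iteratedFDeriv_two_apply]
  simp only [Matrix.cons_val_zero, Matrix.cons_val_one]
  rw [← hdd]
  refine deriv_deriv_nonpos_of_isLocalMax ?_ ?_
  · refine ContinuousAt.comp (f := fun t : ℝ => x + t • v) (g := f) ?_ (hline 0).continuousAt
    simpa using hf.continuousAt
  · have := hcont.eventually h
    simpa [IsLocalMax, IsMaxFilter] using this

/-- The Laplacian computed as the divergence of the gradient. -/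
lemma laplacian_eq_sum_inner {ι : Type*} [Fintype ι] (b : OrthonormalBasis ι ℝ E) {f : E → ℝ}
    {G : E → E} {G' : E →L[ℝ] E} {x : E} (hG : ∀ᶠ y in 𝓝 x, HasGradientAt f (G y) y)
    (hG' : HasFDerivAt G G' x) : Δ f x = ∑ i, inner ℝ (G' (b i)) (b i) := by
  rw [laplacian_eq_iteratedFDeriv_orthonormalBasis f b]
  refine Finset.sum_congr rfl fun i _ => ?_
  have h₁ : fderiv ℝ f =ᶠ[𝓝 x] fun y => innerSL ℝ (G y) := by
    filter_upwards [hG] with y hy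
    exact hy.hasFDerivAt.fderiv
  have h₂ : HasFDerivAt (fun y => innerSL ℝ (G y)) ((innerSL ℝ).comp G') x :=
    (innerSL ℝ (E := E)).hasFDerivAt.comp x hG'
  rw [iteratedFDeriv_two_apply, h₁.fderiv_eq, h₂.fderiv]
  simp

/-- The Laplacian commutes with affine isometries. -/
lemma laplacian_comp_isometry (f : E → ℝ) (L : E ≃ₗᵢ[ℝ] E) (q x : E) :
    Δ (fun y => f (L y + q)) x = Δ f (L x + q) := by
  set b := stdOrthonormalBasis ℝ E
  -- The trace of the Hessian is independent of the orthonormal basis, so the right side may be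
  -- computed in the image of `b` under `L`.
  rw [laplacian_eq_iteratedFDeriv_orthonormalBasis _ b,
    laplacian_eq_iteratedFDeriv_orthonormalBasis f (b.map L)]
  refine Finset.sum_congr rfl fun i _ => ?_
  have h₁ := (L.toContinuousLinearEquiv).iteratedFDerivWithin_comp_right (fun z => f (z + q))
    uniqueDiffOn_univ (x := x) (Set.mem_univ _) 2
  simp only [Set.preimage_univ, iteratedFDerivWithin_univ] at h₁
  have h₂ : (fun z => f (z + q)) ∘ L.toContinuousLinearEquiv = fun y => f (L y + q) := rfl
  rw [h₂] at h₁
  rw [h₁, iteratedFDeriv_comp_add_right]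
  simp only [ContinuousMultilinearMap.compContinuousLinearMap_apply]
  congr 1
  ext j
  fin_cases j <;> rfl

lemma harmonicAt_comp_isometry {f : E → ℝ} {L : E ≃ₗᵢ[ℝ] E} {q x : E}
    (h : HarmonicAt f (L x + q)) : HarmonicAt (fun y => f (L y + q)) x := by
  refine ⟨?_, ?_⟩
  · exact ContDiffAt.comp x h.1 (by fun_prop)
  · have hc : Tendsto (fun y => L y + q) (𝓝 x) (𝓝 (L x + q)) :=
      (L.continuous.add continuous_const).tendsto x
    filter_upwards [hc.eventually h.2] with y hy
    rw [laplacian_comp_isometry, hy]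
    rfl

lemma hasGradientAt_norm_sub_sq (p x : E) :
    HasGradientAt (fun y => ‖y - p‖ ^ 2) ((2 : ℝ) • (x - p)) x := by
  rw [hasGradientAt_iff_hasFDerivAt]
  have := ((hasFDerivAt_id x).sub_const p).norm_sq
  refine this.congr_fderiv ?_
  ext v
  simp

lemma hasGradientAt_inner_sub (p e x : E) :
    HasGradientAt (fun y => inner ℝ e (y - p)) e x := by
  rw [hasGradientAt_iff_hasFDerivAt]
  have := (innerSL ℝ e).hasFDerivAt.comp x ((hasFDerivAt_id x).sub_const p)
  refine this.congr_fderiv ?_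
  ext v
  simp

lemma hasGradientAt_exp_neg_norm_sub_sq (a : ℝ) (p x : E) :
    HasGradientAt (fun y => Real.exp (-a * ‖y - p‖ ^ 2))
      ((-(2 * a) * Real.exp (-a * ‖x - p‖ ^ 2)) • (x - p)) x := by
  have h := hasGradientAt_norm_sub_sq p x
  rw [hasGradientAt_iff_hasFDerivAt] at *
  refine (h.const_mul (-a)).exp.congr_fderiv ?_
  ext v
  simp
  ring

lemma laplacian_exp_neg_norm_sub_sq (a : ℝ) (p x : E) :
    Δ (fun y => Real.exp (-a * ‖y - p‖ ^ 2)) x =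
      2 * a * Real.exp (-a * ‖x - p‖ ^ 2) * (2 * a * ‖x - p‖ ^ 2 - Module.finrank ℝ E) := by
  set b := stdOrthonormalBasis ℝ E
  have hG' := (((hasGradientAt_exp_neg_norm_sub_sq a p x).hasFDerivAt.const_mul
    (-(2 * a))).fun_smul ((hasFDerivAt_id x).sub_const p))
  rw [laplacian_eq_sum_inner b
    (Eventually.of_forall fun y => hasGradientAt_exp_neg_norm_sub_sq a p y) hG']
  have h₂ : ∑ i, inner ℝ (x - p) (b i) * inner ℝ (x - p) (b i) = ‖x - p‖ ^ 2 := by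
    rw [← real_inner_self_eq_norm_sq, ← b.sum_inner_mul_inner]
    exact Finset.sum_congr rfl fun i _ => by rw [real_inner_comm (x - p) (b i)]
  set w := Real.exp (-a * ‖x - p‖ ^ 2)
  have h₃ : ∀ i, inner ℝ (((-(2 * a) * w) • ContinuousLinearMap.id ℝ E +
      (-(2 * a) • (toDual ℝ E) ((-(2 * a) * w) • (x - p))).smulRight (id x - p)) (b i)) (b i) =
      -(2 * a) * w + (4 * a ^ 2 * w) * (inner ℝ (x - p) (b i) * inner ℝ (x - p) (b i)) := by
    intro i
    simp [inner_add_left, inner_sub_left, inner_smul_left]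
    ring
  simp only [h₃, Finset.sum_add_distrib, ← Finset.mul_sum, h₂, Finset.sum_const, Finset.card_univ,
    Fintype.card_fin, nsmul_eq_mul]
  ring

lemma laplacian_quadratic (p e : E) (A B : ℝ) (x : E) :
    Δ (fun y => ‖y - p‖ ^ 2 + (A * inner ℝ e (y - p) + B * inner ℝ e (y - p) ^ 2)) x =
      2 * Module.finrank ℝ E + 2 * B * ‖e‖ ^ 2 := by
  set b := stdOrthonormalBasis ℝ E
  have hG : ∀ y, HasGradientAt
      (fun y => ‖y - p‖ ^ 2 + (A * inner ℝ e (y - p) + B * inner ℝ e (y - p) ^ 2))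
      ((2 : ℝ) • (y - p) + (A + B * (2 * inner ℝ e (y - p))) • e) y := by
    intro y
    have h₁ := (hasGradientAt_norm_sub_sq p y).hasFDerivAt
    have h₂ := (hasGradientAt_inner_sub p e y).hasFDerivAt
    rw [hasGradientAt_iff_hasFDerivAt]
    refine (h₁.fun_add ((h₂.const_mul A).fun_add ((h₂.pow 2).const_mul B))).congr_fderiv ?_
    ext v
    simp
    ring
  have hG' : HasFDerivAt (fun y => (2 : ℝ) • (y - p) + (A + B * (2 * inner ℝ e (y - p))) • e)
      ((2 : ℝ) • ContinuousLinearMap.id ℝ E + ((2 * B) • innerSL ℝ e).smulRight e) x := by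
    have h₂ := (hasGradientAt_inner_sub p e x).hasFDerivAt
    refine ((((hasFDerivAt_id x).sub_const p).const_smul (2 : ℝ)).fun_add
      ((((h₂.const_mul 2).const_mul B).const_add A).smul_const e)).congr_fderiv ?_
    ext v
    simp
    ring_nf
  rw [laplacian_eq_sum_inner b (Eventually.of_forall hG) hG']
  have h₂ : ∑ i, inner ℝ e (b i) * inner ℝ e (b i) = ‖e‖ ^ 2 := by
    rw [← real_inner_self_eq_norm_sq, ← b.sum_inner_mul_inner]
    exact Finset.sum_congr rfl fun i _ => by rw [real_inner_comm e (b i)]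
  have h₃ : ∀ i, inner ℝ (((2 : ℝ) • ContinuousLinearMap.id ℝ E +
      ((2 * B) • innerSL ℝ e).smulRight e) (b i)) (b i) =
      2 + 2 * B * (inner ℝ e (b i) * inner ℝ e (b i)) := by
    intro i
    simp [inner_add_left, inner_smul_left]
    ring
  simp only [h₃, Finset.sum_add_distrib, ← Finset.mul_sum, h₂, Finset.sum_const, Finset.card_univ,
    Fintype.card_fin, nsmul_eq_mul]
  ring

lemma harmonicAt_inner_sub_add (p e : E) (c : ℝ) (x : E) :
    HarmonicAt (fun y => inner ℝ e (y - p) + c) x := by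
  refine ⟨(contDiffAt_const.inner ℝ (contDiffAt_id.sub contDiffAt_const)).add contDiffAt_const,
    Eventually.of_forall fun y => ?_⟩
  have hG : ∀ z, HasGradientAt (fun y => inner ℝ e (y - p) + c) e z := fun z => by
    rw [hasGradientAt_iff_hasFDerivAt]
    exact (hasGradientAt_inner_sub p e z).hasFDerivAt.add_const c
  rw [laplacian_eq_sum_inner (stdOrthonormalBasis ℝ E) (Eventually.of_forall hG)
    (hasFDerivAt_const e y)]
  simp

/-- A quantitative continuity estimate for bounded harmonic functions, by comparison of `h` and its
reflection across the hyperplane through `p` orthogonal to `v`. -/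
lemma harmonic_sub_le {h : E → ℝ} {p v : E} {R M : ℝ} (hR : 0 < R)
    (hh : HarmonicOnNhd h (Metric.closedBall p R))
    (h0 : ∀ x ∈ Metric.closedBall p R, 0 ≤ h x) (hM : ∀ x ∈ Metric.closedBall p R, h x ≤ M)
    (hv : ‖v‖ ≤ R) :
    h (p + v) - h (p - v) ≤ M * ((Module.finrank ℝ E + 1) * ‖v‖ / R) := by
  have hplus : p + v ∈ Metric.closedBall p R := by simpa using hv
  have hminus : p - v ∈ Metric.closedBall p R := by simpa [dist_eq_norm] using hv
  have hM0 : 0 ≤ M := (h0 _ hplus).trans (hM _ hplus)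
  rcases eq_or_lt_of_le hM0 with rfl | hMpos
  · linarith [h0 _ hminus, hM _ hplus]
  rcases eq_or_ne v 0 with rfl | hv0
  · simp
  have hvpos : 0 < ‖v‖ := norm_pos_iff.2 hv0
  set N : ℝ := (Module.finrank ℝ E : ℝ) with hN
  have hN0 : 0 ≤ N := by positivity
  set e : E := ‖v‖⁻¹ • v with he
  have hen : ‖e‖ = 1 := by rw [he, norm_smul, norm_inv, norm_norm, inv_mul_cancel₀ hvpos.ne']
  have hev : inner ℝ e v = ‖v‖ := by
    rw [he, inner_smul_left, real_inner_self_eq_norm_sq]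
    simp
    field_simp
  set L : E ≃ₗᵢ[ℝ] E := (ℝ ∙ e)ᗮ.reflection with hL
  set q : E := p - L p with hq
  have hLq : ∀ x, L x + q = p + L (x - p) := fun x => by rw [hq, map_sub]; abel
  have hmem : ∀ x ∈ Metric.closedBall p R, L x + q ∈ Metric.closedBall p R := by
    intro x hx
    rw [hLq, mem_closedBall_iff_norm, add_sub_cancel_left, L.norm_map]
    exact mem_closedBall_iff_norm.1 hx
  -- With `s = ⟨e, y - p⟩`, this is `|y - p|² + (N + 1) s (R - s)`. Its Laplacian is `2N - 2(N + 1)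
  -- = -2`, it dominates `|y - p|²` on the half ball, and it grows linearly along `e`.
  set ψ : E → ℝ := fun y => ‖y - p‖ ^ 2 +
    ((N + 1) * R * inner ℝ e (y - p) + -(N + 1) * inner ℝ e (y - p) ^ 2) with hψ
  set c : ℝ := M / R ^ 2 with hc
  have hcpos : 0 < c := by positivity
  set g : E → ℝ := fun y => h y - h (L y + q) - c * ψ y with hg
  set D : Set E := Metric.closedBall p R ∩ {y | 0 ≤ inner ℝ e (y - p)} with hD
  have hDc : IsCompact D :=
    (isCompact_closedBall p R).inter_right (isClosed_le continuous_const (by fun_prop))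
  have hpv : p + v ∈ D := ⟨hplus, by simp [hev]⟩
  have hψc : ContDiff ℝ 2 ψ := by
    have : ContDiff ℝ 2 fun y : E => ‖y - p‖ ^ 2 := (contDiff_id.sub contDiff_const).norm_sq ℝ
    have h' : ContDiff ℝ 2 fun y : E => inner ℝ e (y - p) :=
      contDiff_const.inner ℝ (contDiff_id.sub contDiff_const)
    exact this.add ((contDiff_const.mul h').add (contDiff_const.mul (h'.pow 2)))
  have hhL : ∀ x ∈ Metric.closedBall p R, HarmonicAt (fun y => h (L y + q)) x := fun x hx =>
    harmonicAt_comp_isometry (hh _ (hmem x hx))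
  have hgd : ∀ x ∈ Metric.closedBall p R, ContDiffAt ℝ 2 g x := fun x hx =>
    ((hh x hx).1.sub (hhL x hx).1).sub (contDiffAt_const.mul hψc.contDiffAt)
  obtain ⟨z, hzD, hz⟩ := hDc.exists_isMaxOn ⟨_, hpv⟩
    (fun x hx => (hgd x hx.1).continuousAt.continuousWithinAt)
  -- A positive maximum of `g` is excluded on the flat face, where `h` cancels its reflection, on
  -- the spherical face, where `c ψ ≥ M`, and inside, where `Δ g = 2c > 0`.
  have hle : ∀ x ∈ D, g x ≤ 0 := by
    by_contra! hcon
    obtain ⟨x, hxD, hx⟩ := hcon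
    have hgz : 0 < g z := hx.trans_le (hz hxD)
    have hs0 : 0 ≤ inner ℝ e (z - p) := hzD.2
    have hzR : ‖z - p‖ ≤ R := mem_closedBall_iff_norm.1 hzD.1
    have hs1 : inner ℝ e (z - p) ≤ R := by
      refine ((real_inner_le_norm e (z - p)).trans ?_).trans hzR
      rw [hen, one_mul]
    have hψ2 : ‖z - p‖ ^ 2 ≤ ψ z := by
      have : 0 ≤ (N + 1) * (inner ℝ e (z - p) * (R - inner ℝ e (z - p))) := by
        have := mul_nonneg hs0 (sub_nonneg.2 hs1)
        positivity
      simp only [hψ]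
      linarith
    have hspos : 0 < inner ℝ e (z - p) := by
      refine lt_of_le_of_ne hs0 fun h' => ?_
      have hfix : L (z - p) = z - p := by
        rw [hL, Submodule.reflection_eq_self_iff, Submodule.mem_orthogonal_singleton_iff_inner_right]
        exact h'.symm
      have : g z = - (c * ψ z) := by
        simp only [hg, hLq, hfix, add_sub_cancel]
        ring
      have := mul_nonneg hcpos.le ((sq_nonneg _).trans hψ2)
      linarith
    have hzlt : ‖z - p‖ < R := by
      refine lt_of_le_of_ne hzR fun h' => ?_
      have h₁ : M ≤ c * ψ z := by
        calc M = c * R ^ 2 := by rw [hc]; field_simp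
          _ ≤ _ := by rw [h'] at hψ2; gcongr
      have := hM z hzD.1
      have := h0 _ (hmem z hzD.1)
      simp only [hg] at hgz
      linarith
    have hmax : IsLocalMax g z := by
      refine hz.isLocalMax ?_
      refine inter_mem (Metric.closedBall_mem_nhds_of_mem ?_) ?_
      · simpa [dist_eq_norm] using hzlt
      · have : Continuous fun y : E => inner ℝ e (y - p) := by fun_prop
        filter_upwards [(isOpen_lt continuous_const this).mem_nhds hspos] with y hy using le_of_lt hy
    have hΔ := laplacian_nonpos_of_isLocalMax (hgd z hzD.1) hmax
    have h₁ : Δ g z = Δ h z - Δ (fun y => h (L y + q)) z - c * Δ ψ z := by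
      have e₁ := ((hh z hzD.1).1.sub (hhL z hzD.1).1).laplacian_sub
        (contDiffAt_const.mul hψc.contDiffAt : ContDiffAt ℝ 2 (fun y => c * ψ y) z)
      have e₂ := (hh z hzD.1).1.laplacian_sub (hhL z hzD.1).1
      have e₃ := laplacian_smul c (hψc.contDiffAt (x := z))
      rw [← e₂, ← smul_eq_mul, ← e₃]
      exact e₁
    rw [h₁, (hh z hzD.1).2.eq_of_nhds, (hhL z hzD.1).2.eq_of_nhds, laplacian_quadratic, hen] at hΔ
    simp only [Pi.zero_apply] at hΔ
    nlinarith
  have hfin := hle _ hpv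
  have hLv : L v = -v := by
    have : v = ‖v‖ • e := by rw [he, smul_smul, mul_inv_cancel₀ hvpos.ne', one_smul]
    rw [this, map_smul, hL, Submodule.reflection_orthogonalComplement_singleton_eq_neg, smul_neg]
  simp only [hg, hLq, hψ, add_sub_cancel_left, hLv, hev, ← sub_eq_add_neg] at hfin
  have h₂ : c * (‖v‖ ^ 2 + ((N + 1) * R * ‖v‖ + -(N + 1) * ‖v‖ ^ 2)) ≤ M * ((N + 1) * ‖v‖ / R) := by
    calc _ ≤ c * ((N + 1) * R * ‖v‖) := by
          gcongr
          nlinarith [sq_nonneg ‖v‖]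
      _ = _ := by rw [hc]; field_simp
  linarith

/-- Bounded harmonic functions have small oscillation on small concentric balls. -/
lemma harmonic_abs_sub_le {h : E → ℝ} {x y : E} {ρ M : ℝ}
    (hh : HarmonicOnNhd h (Metric.ball y ρ))
    (h0 : ∀ x ∈ Metric.ball y ρ, 0 ≤ h x) (hM : ∀ x ∈ Metric.ball y ρ, h x ≤ M)
    (hρ : 0 < ρ) (hx : ‖x - y‖ < ρ) :
    |h x - h y| ≤ M * ((Module.finrank ℝ E + 1) * ‖x - y‖ / ρ) := by
  set v : E := (1 / 2 : ℝ) • (x - y) with hv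
  set p : E := y + v with hp
  have hvn : ‖v‖ = ‖x - y‖ / 2 := by
    rw [hv, norm_smul]
    norm_num
    ring
  have hx' : p + v = x := by
    have : v + v = x - y := by rw [hv, ← add_smul]; norm_num
    rw [hp, add_assoc, this]
    abel
  -- Since `p` is the midpoint of `x` and `y`, the reflection estimate with `v` and with `-v` bounds
  -- both signs of the difference.
  have hy' : p - v = y := by rw [hp]; abel
  have hsub : Metric.closedBall p (ρ / 2) ⊆ Metric.ball y ρ := by
    refine Metric.closedBall_subset_ball' ?_
    rw [dist_eq_norm, hp, add_sub_cancel_left, hvn]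
    linarith
  have hρ2 : 0 < ρ / 2 := by positivity
  have h₁ := harmonic_sub_le (v := v) hρ2 (hh.mono hsub) (fun x hx => h0 x (hsub hx))
    (fun x hx => hM x (hsub hx)) (by rw [hvn]; linarith)
  have h₂ := harmonic_sub_le (v := -v) hρ2 (hh.mono hsub) (fun x hx => h0 x (hsub hx))
    (fun x hx => hM x (hsub hx)) (by rw [norm_neg, hvn]; linarith)
  rw [hx', hy', hvn] at h₁
  rw [sub_neg_eq_add, ← sub_eq_add_neg, hx', hy', norm_neg, hvn] at h₂
  have h₃ : (Module.finrank ℝ E + 1) * (‖x - y‖ / 2) / (ρ / 2) =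
      (Module.finrank ℝ E + 1) * ‖x - y‖ / ρ := by field_simp
  rw [h₃] at h₁ h₂
  exact abs_le.2 ⟨by linarith, h₁⟩

end Calculus

end VectorialOnePhase

namespace VectorialOnePhase

open InnerProductSpace Laplacian Topology Filter

/-! ### Gaussian barriers. -/

section Barrier

variable {E : Type*} [NormedAddCommGroup E] [InnerProductSpace ℝ E]

/-- The perturbation of the affine function `⟨e, x - p⟩ + c` by a Gaussian centered at `p`. -/
noncomputable def barrier (e p : E) (c κ a : ℝ) (x : E) : ℝ :=
  inner ℝ e (x - p) + c + κ * Real.exp (-a * ‖x - p‖ ^ 2)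

/-- Vertical translates stay in the family, so a barrier slid until it touches is again a barrier.
-/
lemma barrier_add (e p : E) (c κ a t : ℝ) (x : E) :
    barrier e p c κ a x + t = barrier e p (c + t) κ a x := by
  simp only [barrier]
  ring

lemma contDiff_barrier (e p : E) (c κ a : ℝ) : ContDiff ℝ 2 (barrier e p c κ a) := by
  have h₁ : ContDiff ℝ 2 fun y : E => ‖y - p‖ ^ 2 := (contDiff_id.sub contDiff_const).norm_sq ℝ
  have h₂ : ContDiff ℝ 2 fun y : E => inner ℝ e (y - p) :=
    contDiff_const.inner ℝ (contDiff_id.sub contDiff_const)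
  exact (h₂.add contDiff_const).add (contDiff_const.mul (contDiff_const.mul h₁).exp)

lemma norm_sq_add_smul {e : E} (he : ‖e‖ = 1) (t : ℝ) (v : E) :
    ‖e + t • v‖ ^ 2 = 1 + 2 * t * inner ℝ e v + t ^ 2 * ‖v‖ ^ 2 := by
  rw [norm_add_sq_real, he, inner_smul_right, norm_smul, mul_pow, Real.norm_eq_abs, sq_abs]
  ring

variable [FiniteDimensional ℝ E]

lemma gradient_barrier (e p : E) (c κ a : ℝ) (x : E) :
    gradient (barrier e p c κ a) x =
      e + (-(2 * a * κ * Real.exp (-a * ‖x - p‖ ^ 2))) • (x - p) := by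
  refine HasGradientAt.gradient ?_
  have h₁ := (hasGradientAt_inner_sub p e x).hasFDerivAt
  have h₂ := (hasGradientAt_exp_neg_norm_sub_sq a p x).hasFDerivAt
  rw [hasGradientAt_iff_hasFDerivAt]
  refine ((h₁.add_const c).fun_add (h₂.const_mul κ)).congr_fderiv ?_
  ext v
  simp
  ring

lemma laplacian_barrier (e p : E) (c κ a : ℝ) (x : E) :
    Δ (barrier e p c κ a) x =
      κ * (2 * a * Real.exp (-a * ‖x - p‖ ^ 2) * (2 * a * ‖x - p‖ ^ 2 - Module.finrank ℝ E)) := by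
  have h₁ : ContDiff ℝ 2 fun y : E => Real.exp (-a * ‖y - p‖ ^ 2) :=
    (contDiff_const.mul ((contDiff_id.sub contDiff_const).norm_sq ℝ)).exp
  have h₂ := harmonicAt_inner_sub_add p e c x
  rw [← laplacian_exp_neg_norm_sub_sq, ← smul_eq_mul, ← laplacian_smul κ h₁.contDiffAt]
  refine (h₂.1.laplacian_add (contDiff_const.mul h₁).contDiffAt).trans ?_
  rw [h₂.2.eq_of_nhds, Pi.zero_apply, zero_add]
  rfl

/-- A barrier whose Laplacian is positive at `z` cannot touch a harmonic function from below. -/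
lemma not_isLocalMax_barrier_sub {e p z : E} {c κ a ρ : ℝ} {h : E → ℝ} (hκ : 0 < κ) (ha : 0 < a)
    (hρ : Module.finrank ℝ E < 2 * a * ρ ^ 2) (hρ0 : 0 ≤ ρ) (hz : ρ ≤ ‖z - p‖)
    (hh : HarmonicAt h z) : ¬ IsLocalMax (fun y => barrier e p c κ a y - h y) z := by
  intro hmax
  have hb := (contDiff_barrier e p c κ a).contDiffAt (x := z)
  have h₁ := laplacian_nonpos_of_isLocalMax (hb.sub hh.1) hmax
  have h₂ := hb.laplacian_sub hh.1
  have h₃ : Δ (fun y => barrier e p c κ a y - h y) z = Δ (barrier e p c κ a) z - Δ h z := h₂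
  rw [h₃, hh.2.eq_of_nhds, laplacian_barrier] at h₁
  have h₄ : 2 * a * ρ ^ 2 ≤ 2 * a * ‖z - p‖ ^ 2 := by gcongr
  have h₅ : 0 < 2 * a * ‖z - p‖ ^ 2 - Module.finrank ℝ E := by linarith
  have : 0 < κ * (2 * a * Real.exp (-a * ‖z - p‖ ^ 2) *
      (2 * a * ‖z - p‖ ^ 2 - Module.finrank ℝ E)) := by positivity
  simp only [Pi.zero_apply] at h₁
  linarith

end Barrier

/-! ### Comparison of viscosity solutions with barriers. -/

section Comparison

variable {n m : ℕ} {Ω : Set (EuclideanSpace ℝ (Fin n))}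

lemma mem_positivitySet {U : EuclideanSpace ℝ (Fin n) → EuclideanSpace ℝ (Fin m)}
    {x : EuclideanSpace ℝ (Fin n)} (hx : x ∈ Ω) (h : U x ≠ 0) : x ∈ positivitySet Ω U :=
  ⟨hx, norm_pos_iff.2 h⟩

lemma mem_freeBoundary_of_mem_closure
    {U : EuclideanSpace ℝ (Fin n) → EuclideanSpace ℝ (Fin m)}
    {x : EuclideanSpace ℝ (Fin n)} (hx : x ∈ Ω) (h : U x = 0)
    (hcl : x ∈ closure (positivitySet Ω U)) : x ∈ freeBoundary Ω U :=
  ⟨hx, hcl, fun hint => by simpa [h] using (interior_subset hint).2⟩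

lemma IsViscositySolution.harmonicAt_inner
    {U : EuclideanSpace ℝ (Fin n) → EuclideanSpace ℝ (Fin m)} (hU : IsViscositySolution Ω U)
    {x : EuclideanSpace ℝ (Fin n)} (hx : x ∈ positivitySet Ω U)
    (f : EuclideanSpace ℝ (Fin m)) : HarmonicAt (fun y => inner ℝ (U y) f) x := by
  have h₁ : ∀ s : Finset (Fin m), HarmonicAt (fun y => ∑ i ∈ s, f i * U y i) x := by
    intro s
    induction s using Finset.induction_on with
    | empty => simp
    | insert i s hi ih =>
      simp only [Finset.sum_insert hi]
      exact ((hU.harmonic i x hx).const_smul (c := f i)).add ih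
  have h₂ : (fun y => inner ℝ (U y) f) = fun y => ∑ i, f i * U y i := by
    ext y
    simp [PiLp.inner_apply]
  rw [h₂]
  exact h₁ _

/-- An improved lower bound of the first component near `p` propagates to a larger ball. -/
lemma IsViscositySolution.barrier_le
    {U : EuclideanSpace ℝ (Fin n) → EuclideanSpace ℝ (Fin (m + 1))} (hU : IsViscositySolution Ω U)
    {e p : EuclideanSpace ℝ (Fin n)} {c κ a ρ R : ℝ} (he : ‖e‖ = 1) (hκ : 0 < κ) (ha : 0 < a)
    (hρ0 : 0 ≤ ρ) (hρ : n < 2 * a * ρ ^ 2) (hΩ : Metric.closedBall p R ⊆ Ω) (hc : 0 < c)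
    (hle : ∀ x ∈ Metric.closedBall p R, inner ℝ e (x - p) + c ≤ U x 0)
    (hin : ∀ x ∈ Metric.closedBall p ρ,
      barrier e p c κ a x - κ * Real.exp (-a * R ^ 2) ≤ U x 0) :
    ∀ x ∈ Metric.closedBall p R, barrier e p c κ a x - κ * Real.exp (-a * R ^ 2) ≤ U x 0 := by
  by_contra! hcon
  obtain ⟨x, hx, hxlt⟩ := hcon
  have hU0 : ContinuousOn (fun y => U y 0) Ω := by
    have : Continuous fun v : EuclideanSpace ℝ (Fin (m + 1)) => v 0 := by fun_prop
    exact this.comp_continuousOn hU.continuousOn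
  obtain ⟨z, hzB, hz⟩ := (isCompact_closedBall p R).exists_isMaxOn ⟨x, hx⟩
    ((contDiff_barrier e p c κ a).continuous.continuousOn.sub (hU0.mono hΩ))
  have hgz : κ * Real.exp (-a * R ^ 2) < barrier e p c κ a z - U z 0 := by
    have : barrier e p c κ a x - U x 0 ≤ barrier e p c κ a z - U z 0 := hz hx
    linarith
  have hzρ : ρ ≤ ‖z - p‖ := by
    by_contra! hlt
    linarith [hin z (mem_closedBall_iff_norm.2 hlt.le)]
  have hzR : ‖z - p‖ < R := by
    refine lt_of_le_of_ne (mem_closedBall_iff_norm.1 hzB) fun h => ?_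
    have := hle z hzB
    simp only [barrier, h] at hgz
    linarith
  have hmax : IsLocalMax (fun y => barrier e p c κ a y - U y 0) z :=
    hz.isLocalMax (Metric.closedBall_mem_nhds_of_mem (by simpa [dist_eq_norm] using hzR))
  by_cases hUz : U z = 0
  swap
  · exact not_isLocalMax_barrier_sub hκ ha (by simpa using hρ) hρ0 hzρ
      (hU.harmonic 0 z (mem_positivitySet (hΩ hzB) hUz)) hmax
  set t : ℝ := barrier e p c κ a z - U z 0 with ht
  have htouch : ∀ᶠ y in 𝓝 z, barrier e p (c + -t) κ a y ≤ U y 0 := by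
    filter_upwards [hmax] with y hy
    rw [← barrier_add]
    linarith
  -- At a zero of `U` the affine lower bound is nonpositive, so `z` lies below `p`; there the
  -- Gaussian increases in the direction `e`, which makes the slope exceed 1.
  have hs : inner ℝ e (z - p) < 0 := by
    have := hle z hzB
    simp only [hUz, PiLp.zero_apply] at this
    linarith
  have hgrad : 1 < ‖gradient (barrier e p (c + -t) κ a) z‖ := by
    rw [← one_lt_sq_iff₀ (norm_nonneg _), gradient_barrier, norm_sq_add_smul he]
    have h₁ : 0 < 2 * a * κ * Real.exp (-a * ‖z - p‖ ^ 2) := by positivity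
    nlinarith [mul_pos h₁ (neg_pos.2 hs), sq_nonneg
      (2 * a * κ * Real.exp (-a * ‖z - p‖ ^ 2) * ‖z - p‖)]
  by_cases hcl : z ∈ closure (positivitySet Ω U)
  · refine hU.not_touchesBelow z (mem_freeBoundary_of_mem_closure (hΩ hzB) hUz hcl) _
      (contDiff_barrier e p (c + -t) κ a).contDiffAt hgrad (EuclideanSpace.single 0 1) (by simp) ?_
    refine ⟨?_, ?_⟩
    · rw [← barrier_add]
      simp [ht, EuclideanSpace.inner_single_right]
    · filter_upwards [htouch] with y hy
      simpa [EuclideanSpace.inner_single_right] using hy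
  -- Here `U` vanishes near `z`, so the translated barrier has a local maximum at `z`, contradicting
  -- its nonzero gradient.
  · have hΩz : ∀ᶠ y in 𝓝 z, y ∈ Ω := by
      filter_upwards [Metric.closedBall_mem_nhds_of_mem
        (show z ∈ Metric.ball p R by simpa [dist_eq_norm] using hzR)] with y hy using hΩ hy
    have hloc : IsLocalMax (barrier e p (c + -t) κ a) z := by
      filter_upwards [htouch, hΩz, isClosed_closure.isOpen_compl.mem_nhds hcl] with y hy hyΩ hycl
      have hUy : U y = 0 := by
        by_contra hne
        exact hycl (subset_closure (mem_positivitySet hyΩ hne))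
      have hz0 : barrier e p (c + -t) κ a z = U z 0 := by
        rw [← barrier_add, ht]
        ring
      rw [hUz] at hz0
      rw [hUy] at hy
      exact hy.trans_eq hz0.symm
    rw [gradient, hloc.fderiv_eq_zero, map_zero, norm_zero] at hgrad
    linarith

/-- An improved upper bound of `|U|` near `p` propagates to a larger ball. -/
lemma IsViscositySolution.norm_le_barrier
    {U : EuclideanSpace ℝ (Fin n) → EuclideanSpace ℝ (Fin m)} (hU : IsViscositySolution Ω U)
    {S : Set (EuclideanSpace ℝ (Fin n))} (hS : IsOpen S) (hSΩ : S ⊆ Ω)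
    {e p : EuclideanSpace ℝ (Fin n)} {c κ a ρ R d : ℝ} (he : ‖e‖ = 1) (hκ : 0 < κ) (ha : 0 < a)
    (hρ0 : 0 ≤ ρ) (hρ : n < 2 * a * ρ ^ 2) (hRS : Metric.closedBall p R ⊆ S)
    (hd : κ + d ≤ c) (hκd : a * κ * R ^ 2 < d) (hκR : 2 * a * κ * R < 1)
    (hle : ∀ x ∈ S, ‖U x‖ ≤ max (inner ℝ e (x - p) + c) 0)
    (hin : ∀ x ∈ Metric.closedBall p ρ,
      ‖U x‖ ≤ barrier e p c (-κ) a x + κ * Real.exp (-a * R ^ 2)) :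
    ∀ x ∈ Metric.closedBall p R,
      ‖U x‖ ≤ max (barrier e p c (-κ) a x + κ * Real.exp (-a * R ^ 2)) 0 := by
  by_contra! hcon
  obtain ⟨x, hx, hxlt⟩ := hcon
  have hRΩ := hRS.trans hSΩ
  have hUx : U x ≠ 0 := norm_pos_iff.1 ((le_max_right _ _).trans_lt hxlt)
  have hxlt' := (le_max_left _ _).trans_lt hxlt
  -- Restricting to the closure of the positivity set ensures that a maximum point with `U z = 0` is
  -- a free boundary point.
  obtain ⟨z, ⟨hzB, hzcl⟩, hz⟩ := ((isCompact_closedBall p R).inter_right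
    (isClosed_closure (s := positivitySet Ω U))).exists_isMaxOn
    ⟨x, hx, subset_closure (mem_positivitySet (hRΩ hx) hUx)⟩
    ((hU.continuousOn.norm.mono (Set.inter_subset_left.trans hRΩ)).sub
      (contDiff_barrier e p c (-κ) a).continuous.continuousOn)
  have hgz : κ * Real.exp (-a * R ^ 2) < ‖U z‖ - barrier e p c (-κ) a z := by
    have : ‖U x‖ - barrier e p c (-κ) a x ≤ ‖U z‖ - barrier e p c (-κ) a z :=
      hz ⟨hx, subset_closure (mem_positivitySet (hRΩ hx) hUx)⟩
    linarith
  have hlz : 0 ≤ inner ℝ e (z - p) + c := by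
    by_contra! hneg
    have hcont : Continuous fun y => inner ℝ e (y - p) + c := by fun_prop
    obtain ⟨y, ⟨hyS, hyneg⟩, hyΩ, hypos⟩ := mem_closure_iff_nhds.1 hzcl _
      (inter_mem (hS.mem_nhds (hRS hzB)) ((isOpen_lt hcont continuous_const).mem_nhds hneg))
    have := hle y hyS
    rw [max_eq_right (le_of_lt hyneg)] at this
    linarith
  have hzρ : ρ ≤ ‖z - p‖ := by
    by_contra! hlt
    linarith [hin z (mem_closedBall_iff_norm.2 hlt.le)]
  have hzR' : ‖z - p‖ ≤ R := mem_closedBall_iff_norm.1 hzB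
  have hzR : ‖z - p‖ < R := by
    refine lt_of_le_of_ne hzR' fun h => ?_
    have := hle z (hRS hzB)
    rw [max_eq_left hlz] at this
    simp only [barrier, h] at hgz
    linarith
  have hBz : Metric.closedBall p R ∈ 𝓝 z :=
    Metric.closedBall_mem_nhds_of_mem (by simpa [dist_eq_norm] using hzR)
  set t : ℝ := ‖U z‖ - barrier e p c (-κ) a z with ht
  have htouch : ∀ᶠ y in 𝓝 z, U y ≠ 0 → ‖U y‖ ≤ barrier e p c (-κ) a y + t := by
    filter_upwards [hBz] with y hy hne
    have : ‖U y‖ - barrier e p c (-κ) a y ≤ t :=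
      hz ⟨hy, subset_closure (mem_positivitySet (hRΩ hy) hne)⟩
    linarith
  by_cases hUz : U z = 0
  swap
  · have hnz : ‖U z‖ ≠ 0 := norm_ne_zero_iff.2 hUz
    -- In this direction the harmonic function `⟨U, f⟩` is at least `-|U|`, with equality at `z`, so
    -- contact for `|U|` becomes contact from below for a harmonic function.
    set f := (-‖U z‖⁻¹) • U z with hf
    have hfn : ‖f‖ = 1 := by
      rw [hf, norm_smul, norm_neg, norm_inv, norm_norm, inv_mul_cancel₀ hnz]
    refine not_isLocalMax_barrier_sub (e := -e) (p := p) (c := -c) (z := z) hκ ha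
      (by simpa using hρ) hρ0 hzρ
      (hU.harmonicAt_inner (mem_positivitySet (hRΩ hzB) hUz) f) ?_
    have hbar : ∀ y, barrier (-e) p (-c) κ a y = - barrier e p c (-κ) a y := fun y => by
      simp only [barrier, inner_neg_left]
      ring
    have hfz : inner ℝ (U z) f = -‖U z‖ := by
      rw [hf, inner_smul_right, real_inner_self_eq_norm_sq]
      field_simp
    have hne : ∀ᶠ y in 𝓝 z, U y ≠ 0 :=
      (hU.continuousOn.continuousAt (mem_of_superset hBz hRΩ)).eventually_ne hUz
    filter_upwards [htouch, hne] with y hy hyne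
    have h₁ := hy hyne
    have h₂ := neg_le_of_abs_le (abs_real_inner_le_norm (U y) f)
    rw [hfn, mul_one] at h₂
    rw [hbar, hbar, hfz]
    linarith
  have hexp0 := Real.exp_pos (-a * ‖z - p‖ ^ 2)
  have hexp1 : Real.exp (-a * ‖z - p‖ ^ 2) ≤ 1 := by
    rw [Real.exp_le_one_iff, neg_mul]
    exact neg_nonpos.2 (by positivity)
  have hs : inner ℝ e (z - p) < -d := by
    have h₁ : 0 < κ * Real.exp (-a * R ^ 2) := by positivity
    have h₂ := mul_le_mul_of_nonneg_left hexp1 hκ.le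
    simp only [ht, hUz, norm_zero, barrier] at hgz
    linarith
  have hs' : -R ≤ inner ℝ e (z - p) := by
    have h₁ := neg_le_of_abs_le (abs_real_inner_le_norm e (z - p))
    rw [he, one_mul] at h₁
    linarith
  have hR0 : 0 ≤ R := (norm_nonneg _).trans hzR'
  set W := Real.exp (-a * ‖z - p‖ ^ 2) with hW
  have hφ := contDiff_barrier e p (c + t) (-κ) a
  have hgrad : gradient (barrier e p (c + t) (-κ) a) z = e + (2 * a * κ * W) • (z - p) := by
    rw [gradient_barrier]
    congr 2
    ring
  have hτ : 0 < 2 * a * κ * W := by positivity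
  refine hU.not_touchesAbove z (mem_freeBoundary_of_mem_closure (hRΩ hzB) hUz hzcl) _
    hφ.contDiffAt ?_ ?_ ?_ ⟨?_, ?_⟩
  · rw [← barrier_add, ht, hUz, norm_zero]
    ring
  -- The `e`-component of the gradient is at least `1 - 2aκR > 0`.
  · intro h0
    rw [hgrad] at h0
    have h₁ : inner ℝ e (e + (2 * a * κ * W) • (z - p)) = 0 := by rw [h0, inner_zero_right]
    rw [inner_add_right, inner_smul_right, real_inner_self_eq_norm_sq, he] at h₁
    have h₂ : 2 * a * κ * W * -R ≤ 2 * a * κ * W * inner ℝ e (z - p) := by gcongr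
    have h₃ : 2 * a * κ * R * W ≤ 2 * a * κ * R * 1 := by gcongr
    linarith
  -- The linear term, with `⟨e, z - p⟩ < -d`, beats the quadratic one because `aκR² < d`.
  · rw [← sq_lt_one_iff₀ (norm_nonneg _), hgrad, norm_sq_add_smul he]
    have h₁ : ‖z - p‖ ^ 2 ≤ R ^ 2 := by gcongr
    have h₂ : a * κ * W * ‖z - p‖ ^ 2 ≤ a * κ * 1 * R ^ 2 := by gcongr
    nlinarith [mul_pos hτ (show 0 < -d - inner ℝ e (z - p) by linarith),
      mul_pos hτ (show 0 < d - a * κ * W * ‖z - p‖ ^ 2 by linarith)]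
  · change max (barrier e p (c + t) (-κ) a z) 0 = ‖U z‖
    rw [← barrier_add, ht, hUz, norm_zero]
    simp
  · filter_upwards [htouch] with y hy
    by_cases hUy : U y = 0
    · simp [hUy]
    · rw [← barrier_add]
      exact (hy hUy).trans (le_max_left _ _)

end Comparison

end VectorialOnePhase

/-! ### The partial Harnack inequality. -/

namespace VectorialOnePhase

open InnerProductSpace Topology Filter

variable {n m : ℕ}

/-- If the components of `U` other than the first are of size `r t ^ (3/4)` with `t` small and
the first one is of size at least `r / 20`, then `|U|` exceeds the first component by at most
`r t / 8`. -/
lemma norm_le_first_add {v : EuclideanSpace ℝ (Fin (m + 1))} {r t : ℝ} (hr : 0 < r) (ht : 0 ≤ t)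
    (ht' : t ≤ 1 / (80 * (m + 1)) ^ 2) (h0 : r / 20 ≤ v 0)
    (hi : ∀ i, i ≠ 0 → |v i| ≤ r * t ^ (3 / 4 : ℝ)) : ‖v‖ ≤ v 0 + r * t / 8 := by
  set q : ℝ := t ^ (3 / 4 : ℝ) with hq
  have hq0 : 0 ≤ q := Real.rpow_nonneg ht _
  have hq4 : q ^ 4 = t ^ 3 := by
    rw [hq, ← Real.rpow_natCast, ← Real.rpow_mul ht, ← Real.rpow_natCast]
    norm_num
  have hm : (0 : ℝ) < 80 * (m + 1) := by positivity
  have hq2 : q ^ 2 ≤ t / (80 * (m + 1)) := by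
    refine (sq_le_sq₀ (by positivity) (by positivity)).1 ?_
    calc (q ^ 2) ^ 2 = t ^ 2 * t := by rw [← pow_mul, hq4]; ring
      _ ≤ t ^ 2 * (1 / (80 * (m + 1)) ^ 2) := by gcongr
      _ = _ := by rw [div_pow]; ring
  have hsum : ∑ i : Fin m, v i.succ ^ 2 ≤ r ^ 2 * t / 80 := by
    calc ∑ i : Fin m, v i.succ ^ 2 ≤ ∑ _i : Fin m, r ^ 2 * q ^ 2 := by
          refine Finset.sum_le_sum fun i _ => ?_
          rw [← mul_pow, ← sq_abs]
          exact pow_le_pow_left₀ (abs_nonneg _) (hi _ (Fin.succ_ne_zero i)) 2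
      _ = m * (r ^ 2 * q ^ 2) := by simp
      _ ≤ (m + 1) * (r ^ 2 * (t / (80 * (m + 1)))) := by gcongr; linarith
      _ = _ := by field_simp
  have h00 : 0 ≤ v 0 := by linarith
  refine (sq_le_sq₀ (norm_nonneg _) (by positivity)).1 ?_
  rw [EuclideanSpace.real_norm_sq_eq, Fin.sum_univ_succ]
  -- The cross term `v 0 * (r * t) / 4` of the squared right side is at least `r² t / 80`, which
  -- absorbs the sum.
  have h₁ : r / 20 * (r * t) ≤ v 0 * (r * t) := by gcongr
  nlinarith [sq_nonneg (r * t)]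

lemma TrappedOn.mono {U : EuclideanSpace ℝ (Fin (n + 1)) → EuclideanSpace ℝ (Fin (m + 1))}
    {a b : ℝ} {S T : Set (EuclideanSpace ℝ (Fin (n + 1)))} (h : TrappedOn U a b T) (hST : S ⊆ T) :
    TrappedOn U a b S := fun x hx => h x (hST hx)

lemma exists_pos_of_mem {U : EuclideanSpace ℝ (Fin n) → EuclideanSpace ℝ (Fin m)}
    {Ω S : Set (EuclideanSpace ℝ (Fin n))} {x₀ : EuclideanSpace ℝ (Fin n)}
    (hx₀ : x₀ ∈ positivitySet Ω U ∪ freeBoundary Ω U) (hS : S ∈ 𝓝 x₀) : ∃ y ∈ S, 0 < ‖U y‖ := by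
  have hcl : x₀ ∈ closure (positivitySet Ω U) :=
    hx₀.elim (fun h => subset_closure h) fun h => frontier_subset_closure h.2
  obtain ⟨y, hyS, -, hy⟩ := mem_closure_iff_nhds.1 hcl S hS
  exact ⟨y, hyS, hy⟩

/-- The partial Harnack inequality, for explicit values of the parameters. -/
lemma IsViscositySolution.exists_improvement {Ω : Set (EuclideanSpace ℝ (Fin (n + 1)))}
    {U : EuclideanSpace ℝ (Fin (n + 1)) → EuclideanSpace ℝ (Fin (m + 1))}
    (hU : IsViscositySolution Ω U) {x₀ : EuclideanSpace ℝ (Fin (n + 1))} {r a₀ b₀ α δ : ℝ}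
    (hδ : δ = 1 / (4 * (n + 2))) (hα : α = 100 * (n + 1) / δ ^ 2)
    (hr : 0 < r) (hΩ : Metric.ball x₀ r ⊆ Ω) (hT : TrappedOn U a₀ b₀ (Metric.ball x₀ r))
    (hab : a₀ < b₀) (hx₀ : 0 ≤ x₀ (Fin.last n) + b₀)
    (hε₁ : b₀ - a₀ ≤ 1 / 20 * r) (hε₂ : b₀ - a₀ ≤ 1 / (2 * α) * r)
    (hε₃ : b₀ - a₀ ≤ 1 / (80 * (m + 1)) ^ 2 * r)
    (hflat : ∀ x ∈ Metric.ball x₀ (r / 2), ∀ i : Fin (m + 1), i ≠ 0 →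
      |U x i| ≤ r * ((b₀ - a₀) / r) ^ (3 / 4 : ℝ)) :
    ∃ a₁ b₁ : ℝ, a₀ ≤ a₁ ∧ b₁ ≤ b₀ ∧
      b₁ - a₁ = (1 - (Real.exp (-α / 16) - Real.exp (-α * 9 / 16)) / 8) * (b₀ - a₀) ∧
      TrappedOn U a₁ b₁ (Metric.ball x₀ (r / 20)) := by
  set η := b₀ - a₀ with hη
  have hη0 : 0 < η := sub_pos.2 hab
  have hδ0 : 0 < δ := by rw [hδ]; positivity
  have hδ1 : δ < 1 := by
    rw [hδ, div_lt_one (by positivity)]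
    linarith [(Nat.cast_nonneg n : (0 : ℝ) ≤ n)]
  have hα0 : 0 < α := by rw [hα]; positivity
  have hηα : α * η ≤ r / 2 := by
    calc α * η ≤ α * (1 / (2 * α) * r) := by gcongr
      _ = r / 2 := by field_simp
  set e : EuclideanSpace ℝ (Fin (n + 1)) := EuclideanSpace.single (Fin.last n) 1 with he
  have hen : ‖e‖ = 1 := by simp [he]
  set p := x₀ + (r / 5) • e with hp
  have hpn : p (Fin.last n) = x₀ (Fin.last n) + r / 5 := by simp [hp, he]
  have hinner : ∀ (x : EuclideanSpace ℝ (Fin (n + 1))) (c : ℝ),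
      inner ℝ e (x - p) + (p (Fin.last n) + c) = x (Fin.last n) + c := by
    intro x c
    simp [he, EuclideanSpace.inner_single_left]
    ring
  have hpx₀ : ‖p - x₀‖ = r / 5 := by
    rw [hp, add_sub_cancel_left, norm_smul, hen, mul_one, Real.norm_of_nonneg (by positivity)]
  have hball : Metric.closedBall p (3 * r / 4) ⊆ Metric.ball x₀ r := by
    refine Metric.closedBall_subset_ball' ?_
    rw [dist_eq_norm, hpx₀]
    linarith
  have hball₂ : Metric.ball p (r / 10) ⊆ Metric.ball x₀ (r / 2) := by
    refine Metric.ball_subset_ball' ?_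
    rw [dist_eq_norm, hpx₀]
    linarith
  have hball₃ : Metric.ball p (r / 10) ⊆ Metric.ball x₀ r :=
    hball₂.trans (Metric.ball_subset_ball (by linarith))
  have hball₄ : Metric.ball x₀ (r / 20) ⊆ Metric.closedBall p (r / 4) := by
    refine Metric.ball_subset_closedBall.trans (Metric.closedBall_subset_closedBall' ?_)
    rw [dist_comm, dist_eq_norm, hpx₀]
    linarith
  have hball₅ : Metric.ball x₀ (r / 20) ⊆ Metric.closedBall p (3 * r / 4) :=
    hball₄.trans (Metric.closedBall_subset_closedBall (by linarith))
  have hball₆ : Metric.ball x₀ (r / 20) ⊆ Metric.ball x₀ r :=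
    Metric.ball_subset_ball (by linarith)
  set ρ := δ * (r / 10) with hρ
  have hρ0 : 0 < ρ := by positivity
  have hρr : ρ < r / 10 := by
    rw [hρ]
    exact mul_lt_of_lt_one_left (by positivity) hδ1
  set a := α / r ^ 2 with ha
  have ha0 : 0 < a := by positivity
  -- The choice of `α` gives `2aρ² = 2(n + 1)`, twice the dimension, so the bump is strictly
  -- subharmonic outside `B_ρ(p)`.
  have haρ : ((n + 1 : ℕ) : ℝ) < 2 * a * ρ ^ 2 := by
    have : 2 * a * ρ ^ 2 = 2 * (n + 1) := by
      rw [ha, hρ, hα]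
      field_simp
      norm_num
    rw [this]
    push_cast
    linarith [(Nat.cast_nonneg n : (0 : ℝ) ≤ n)]
  have haR : -a * (3 * r / 4) ^ 2 = -α * 9 / 16 := by
    rw [ha]
    field_simp
    norm_num
  have hlow : ∀ x ∈ Metric.closedBall p (r / 4),
      Real.exp (-α / 16) ≤ Real.exp (-a * ‖x - p‖ ^ 2) := by
    intro x hx
    have h₁ : ‖x - p‖ ^ 2 ≤ (r / 4) ^ 2 := by
      gcongr
      exact mem_closedBall_iff_norm.1 hx
    have h₂ : a * (r / 4) ^ 2 = α / 16 := by
      rw [ha]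
      field_simp
      norm_num
    rw [Real.exp_le_exp]
    nlinarith
  have hexp1 : ∀ x, Real.exp (-a * ‖x - p‖ ^ 2) ≤ 1 := fun x => by
    rw [Real.exp_le_one_iff, neg_mul]
    exact neg_nonpos.2 (by positivity)
  set E₀ := Real.exp (-α * 9 / 16) with hE₀
  have hE₀pos : 0 < E₀ := Real.exp_pos _
  set h : EuclideanSpace ℝ (Fin (n + 1)) → ℝ :=
    (fun x => U x 0) - fun x => inner ℝ e (x - p) + (p (Fin.last n) + a₀) with hh
  have hh' : ∀ x, h x = U x 0 - (x (Fin.last n) + a₀) := fun x => by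
    rw [← hinner x a₀]
    rfl
  -- The height is at least `r/5 - r/10 - η`, and `η ≤ r/20`; hence `U ≠ 0` on this ball.
  have hxn : ∀ x ∈ Metric.ball p (r / 10), r / 20 ≤ x (Fin.last n) + a₀ := by
    intro x hx
    have h₁ := abs_real_inner_le_norm e (x - p)
    rw [hen, one_mul] at h₁
    have h₂ := neg_le_of_abs_le (h₁.trans (mem_ball_iff_norm.1 hx).le)
    have h₃ := hinner x a₀
    linarith
  have hhpos : ∀ x ∈ Metric.ball p (r / 10), 0 ≤ h x := fun x hx => by
    rw [hh']
    linarith [(hT x (hball₃ hx)).1]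
  have hhle : ∀ x ∈ Metric.ball p (r / 10), h x ≤ η := fun x hx => by
    rw [hh']
    have h₁ := (hT x (hball₃ hx)).2.1.trans (hT x (hball₃ hx)).2.2
    rw [max_eq_left (by linarith [hxn x hx])] at h₁
    linarith
  have hharm : HarmonicOnNhd h (Metric.ball p (r / 10)) := fun x hx => by
    refine (hU.harmonic 0 x ⟨hΩ (hball₃ hx), ?_⟩).sub (harmonicAt_inner_sub_add p e _ x)
    linarith [hxn x hx, (hT x (hball₃ hx)).1, (hT x (hball₃ hx)).2.1]
  have hosc : ∀ x ∈ Metric.closedBall p ρ, |h x - h p| ≤ η / 4 := by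
    intro x hx
    have hxp : ‖x - p‖ ≤ ρ := mem_closedBall_iff_norm.1 hx
    refine (harmonic_abs_sub_le hharm hhpos hhle (by positivity) (hxp.trans_lt hρr)).trans ?_
    rw [finrank_euclideanSpace_fin]
    calc η * ((((n + 1 : ℕ) : ℝ) + 1) * ‖x - p‖ / (r / 10))
        ≤ η * ((((n + 1 : ℕ) : ℝ) + 1) * ρ / (r / 10)) := by gcongr
      _ = η / 4 := by
        rw [hρ, hδ]
        push_cast
        field_simp
        ring
  have hsub : Metric.closedBall p ρ ⊆ Metric.ball p (r / 10) :=
    Metric.closedBall_subset_ball hρr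
  have hκ : 0 < η / 8 := by positivity
  have hκexp : ∀ x, η / 8 * Real.exp (-a * ‖x - p‖ ^ 2) ≤ η / 8 := fun x =>
    mul_le_of_le_one_right hκ.le (hexp1 x)
  have hκE : 0 < η / 8 * E₀ := by positivity
  rcases le_total (η / 2) (h p) with hcase | hcase
  · have key := hU.barrier_le (c := p (Fin.last n) + a₀) (R := 3 * r / 4) hen hκ ha0 hρ0.le haρ
      (hball.trans hΩ) (by linarith) (fun x hx => by rw [hinner]; exact (hT x (hball hx)).1) ?_
    · refine ⟨a₀ + (Real.exp (-α / 16) - E₀) / 8 * η, b₀, ?_, le_rfl, by rw [hη]; ring,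
        fun x hx => ⟨?_, (hT x (hball₆ hx)).2⟩⟩
      · have : E₀ ≤ Real.exp (-α / 16) := Real.exp_le_exp.2 (by linarith)
        have := mul_nonneg (sub_nonneg.2 this) hη0.le
        linarith
      · have h₁ := key x (hball₅ hx)
        have h₂ := mul_le_mul_of_nonneg_left (hlow x (hball₄ hx)) hκ.le
        rw [barrier, hinner, haR] at h₁
        linarith
    · intro x hx
      have h₁ := neg_le_of_abs_le (hosc x hx)
      rw [hh' x] at h₁
      rw [barrier, hinner, haR]
      linarith [hκexp x]
  · have hR2 : a * (η / 8) * (3 * r / 4) ^ 2 < r / 10 := by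
      have : a * (η / 8) * (3 * r / 4) ^ 2 = 9 / 128 * (α * η) := by
        rw [ha]
        field_simp
        norm_num
      rw [this]
      linarith
    have hR1 : 2 * a * (η / 8) * (3 * r / 4) < 1 := by
      have : 2 * a * (η / 8) * (3 * r / 4) = 3 / 16 * (α * η) / r := by
        rw [ha]
        field_simp
        norm_num
      rw [this, div_lt_one hr]
      linarith
    have key := hU.norm_le_barrier (c := p (Fin.last n) + b₀) (R := 3 * r / 4) (d := r / 10)
      Metric.isOpen_ball hΩ hen hκ ha0 hρ0.le haρ hball (by linarith) hR2 hR1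
      (fun x hx => by rw [hinner]; exact (hT x hx).2.2) ?_
    · refine ⟨a₀, b₀ - (Real.exp (-α / 16) - E₀) / 8 * η, le_rfl, ?_, by rw [hη]; ring,
        fun x hx => ⟨(hT x (hball₆ hx)).1, (hT x (hball₆ hx)).2.1, ?_⟩⟩
      · have : E₀ ≤ Real.exp (-α / 16) := Real.exp_le_exp.2 (by linarith)
        have := mul_nonneg (sub_nonneg.2 this) hη0.le
        linarith
      · refine (key x (hball₅ hx)).trans (max_le_max ?_ le_rfl)
        have h₂ := mul_le_mul_of_nonneg_left (hlow x (hball₄ hx)) hκ.le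
        rw [barrier, hinner, haR]
        linarith
    -- On `B_ρ(p)`, `u¹ ≤ xₙ + b₀ - η/4`. Passing to `|U|` costs `η/8`, and the remaining `η/8` is
    -- the height of the bump.
    · intro x hx
      have h₁ := le_of_abs_le (hosc x hx)
      rw [hh' x] at h₁
      have h₂ : ‖U x‖ ≤ U x 0 + r * (η / r) / 8 := by
        refine norm_le_first_add hr (by positivity) ?_ ?_ fun i hi =>
          hflat x (hball₂ (hsub hx)) i hi
        · rwa [div_le_iff₀ hr]
        · linarith [hxn x (hsub hx), (hT x (hball₃ (hsub hx))).1]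
      rw [mul_div_cancel₀ _ hr.ne'] at h₂
      rw [barrier, hinner, haR]
      linarith [hκexp x]

end VectorialOnePhase

theorem theorem2p1 (n m : ℕ) :
    ∃ εbar : ℝ, 0 < εbar ∧ ∃ c : ℝ, 0 < c ∧ c < 1 ∧
      ∀ (U : EuclideanSpace ℝ (Fin (n + 1)) → EuclideanSpace ℝ (Fin (m + 1)))
        (x₀ : EuclideanSpace ℝ (Fin (n + 1))) (r a₀ b₀ : ℝ),
        VectorialOnePhase.IsViscositySolution (Metric.ball 0 1) U →
        x₀ ∈ VectorialOnePhase.positivitySet (Metric.ball 0 1) U ∪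
          VectorialOnePhase.freeBoundary (Metric.ball 0 1) U →
        0 < r →
        Metric.ball x₀ r ⊆ Metric.ball 0 1 →
        VectorialOnePhase.TrappedOn U a₀ b₀ (Metric.ball x₀ r) →
        b₀ - a₀ ≤ εbar * r →
        (∀ x ∈ Metric.ball x₀ (r / 2), ∀ i : Fin (m + 1), i ≠ 0 →
          |U x i| ≤ r * ((b₀ - a₀) / r) ^ (3 / 4 : ℝ)) →
        ∃ a₁ b₁ : ℝ, a₀ ≤ a₁ ∧ a₁ ≤ b₁ ∧ b₁ ≤ b₀ ∧ b₁ - a₁ = (1 - c) * (b₀ - a₀) ∧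
          VectorialOnePhase.TrappedOn U a₁ b₁ (Metric.ball x₀ (r / 20)) := by
  obtain ⟨δ, hδ⟩ : ∃ δ : ℝ, δ = 1 / (4 * (n + 2)) := ⟨_, rfl⟩
  obtain ⟨α, hα⟩ : ∃ α : ℝ, α = 100 * (n + 1) / δ ^ 2 := ⟨_, rfl⟩
  have hδ0 : 0 < δ := by rw [hδ]; positivity
  have hα0 : 0 < α := by rw [hα]; positivity
  have hexp : Real.exp (-α * 9 / 16) < Real.exp (-α / 16) := Real.exp_lt_exp.2 (by linarith)
  have hexp1 : Real.exp (-α / 16) ≤ 1 := Real.exp_le_one_iff.2 (by linarith)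
  have hexp0 := Real.exp_pos (-α * 9 / 16)
  set c := (Real.exp (-α / 16) - Real.exp (-α * 9 / 16)) / 8 with hc
  have hc1 : c < 1 := by linarith
  refine ⟨min (1 / 20) (min (1 / (2 * α)) (1 / (80 * (m + 1)) ^ 2)), by positivity, c,
    by linarith, hc1, ?_⟩
  intro U x₀ r a₀ b₀ hU hx₀ hr hΩ hT hε hflat
  -- The order `a₀ ≤ b₀` is not assumed: it follows from the trapping at a point where `U ≠ 0`, and
  -- such points accumulate at `x₀`.
  have hlin : ∀ y ∈ Metric.ball x₀ r, 0 < ‖U y‖ →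
      0 < y (Fin.last n) + b₀ ∧ a₀ ≤ b₀ := by
    intro y hy hUy
    have h₁ := hT y hy
    have h₂ : 0 < y (Fin.last n) + b₀ := by
      by_contra! hneg
      linarith [h₁.2.2, max_eq_right hneg]
    rw [max_eq_left h₂.le] at h₁
    exact ⟨h₂, by linarith [h₁.1, h₁.2.1, h₁.2.2]⟩
  have hab : a₀ ≤ b₀ := by
    obtain ⟨y, hy, hUy⟩ := VectorialOnePhase.exists_pos_of_mem hx₀ (Metric.ball_mem_nhds x₀ hr)
    exact (hlin y hy hUy).2
  have hx₀b : 0 ≤ x₀ (Fin.last n) + b₀ := by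
    by_contra! hneg
    have hcont : Continuous fun y : EuclideanSpace ℝ (Fin (n + 1)) => y (Fin.last n) + b₀ := by
      fun_prop
    obtain ⟨y, ⟨hy, hyneg⟩, hUy⟩ := VectorialOnePhase.exists_pos_of_mem hx₀
      (Filter.inter_mem (Metric.ball_mem_nhds x₀ hr)
        ((isOpen_lt hcont continuous_const).mem_nhds hneg))
    exact lt_asymm hyneg (hlin y hy hUy).1
  rcases eq_or_lt_of_le hab with rfl | hlt
  · exact ⟨a₀, a₀, le_rfl, le_rfl, le_rfl, by ring,
      hT.mono (Metric.ball_subset_ball (by linarith))⟩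
  · have hε' : ∀ t, min (1 / 20) (min (1 / (2 * α)) (1 / (80 * ((m : ℝ) + 1)) ^ 2)) ≤ t →
        b₀ - a₀ ≤ t * r := fun t ht => hε.trans (mul_le_mul_of_nonneg_right ht hr.le)
    obtain ⟨a₁, b₁, h₁, h₂, h₃, h₄⟩ := hU.exists_improvement hδ hα hr hΩ hT hlt hx₀b
      (hε' _ (min_le_left _ _)) (hε' _ ((min_le_right _ _).trans (min_le_left _ _)))
      (hε' _ ((min_le_right _ _).trans (min_le_right _ _))) hflat
    rw [← hc] at h₃
    refine ⟨a₁, b₁, h₁, ?_, h₂, h₃, h₄⟩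
    have := mul_nonneg (sub_nonneg.2 hc1.le) (sub_nonneg.2 hab)
    linarith
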